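/- **Setting.** A subshift is a closed set $X\subseteq\{0,1\}^{\mathbb N_0}$ with $\sigma(X)\subseteq X$, where $(\sigma x)(n)=x(n+1)$; it is minimal if it is nonempty and properly contains no nonempty subshift. For a finite $\tau\subseteq\mathbb N_0$ let $L_X(\tau)=\{(\sigma^n x)|_\tau : x\in X,\ n\ge 0\}\subseteq\{0,1\}^\tau$, and let $p^*_X(n)=\max_{|\tau|=n}|L_X(\tau)|$ be the maximal pattern complexity. $X$ has non-superlinear maximal pattern complexity if $\liminf_{n\to\infty}p^*_X(n)/n<\infty$. $X$ is null if the topological sequence entropy of $(X,\sigma)$ is zero along every increasing sequence of nonnegative integers. The maximal equicontinuous factor (MEF) of a minimal $X$ is the largest rotation $(G,+g_0)$ of a compact Hausdorff abelian group that is a factor of $(X,\sigma)$: every other such rotation that is a factor of $(X,\sigma)$ factors through it. An MEF partition associated to $X$ is a partition $G=U_0\sqcup U_1\sqcup B$ with $U_0,U_1$ open and nonempty and $B=\partial U_0=\partial U_1$, for which there is $x_0\in X$ such that for all $n\ge 0$ we have $ng_0\notin B$ and, for $i\in\{0,1\}$, $x_0(n)=i$ if and only if $ng_0\in U_i$. **Theorem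 4.1.** Let $X$ be a minimal subshift with MEF $(G,+g_0)$ and let $\{U_0,U_1,B\}$ be an MEF partition associated to $X$. 1. If $X$ is null, then for every integer $k\ge 0$ with $|B|\ge k$ (where $B$ may be infinite), $$\inf_{n\in\mathbb N}\bigl(p^*_X(n)-kn\bigr)>-\infty .$$ 2. (Corollary) If $X$ has non-superlinear maximal pattern complexity, then $B$ is finite. -/

import Mathlib

open Set Filter Topology
open scoped ENNReal
open SymbolicDynamics.FullShift (Subshift shift)

noncomputable section

/-! ### Topological dynamical systems: factors, sequence entropy, null systems -/

section Dynamics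

universe u v

/-- `φ` is a factor map from the system `(X, T)` onto the system `(Y, S)`. -/
structure IsFactorMap {X : Type u} {Y : Type v} [TopologicalSpace X] [TopologicalSpace Y]
    (T : X → X) (S : Y → Y) (φ : X → Y) : Prop where
  continuous : Continuous φ
  surjective : Function.Surjective φ
  semiconj : Function.Semiconj φ T S

/-- The least cardinality of a finite subfamily of `𝒰` that covers `X`. -/
def minSubcoverCard {X : Type u} (𝒰 : Set (Set X)) : ℕ :=
  sInf {k : ℕ | ∃ F : Finset (Set X),
    (F : Set (Set X)) ⊆ 𝒰 ∧ ⋃₀ (F : Set (Set X)) = univ ∧ F.card = k}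

/-- The common refinement of the covers `T⁻ᵃ⁽⁰⁾ 𝒰, …, T⁻ᵃ⁽ⁿ⁻¹⁾ 𝒰`. -/
def coverJoin {X : Type u} (T : X → X) (a : ℕ → ℕ) (𝒰 : Set (Set X)) (n : ℕ) : Set (Set X) :=
  {W | ∃ V : Fin n → Set X, (∀ i, V i ∈ 𝒰) ∧ W = ⋂ i : Fin n, T^[a i] ⁻¹' V i}

/-- The topological entropy of `T` along the sequence `a`, relative to the cover `𝒰`. -/
def seqEntropyOfCover {X : Type u} (T : X → X) (a : ℕ → ℕ) (𝒰 : Set (Set X)) : EReal :=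
  limsup (fun n : ℕ =>
    ((Real.log (minSubcoverCard (coverJoin T a 𝒰 n)) / n : ℝ) : EReal)) atTop

/-- The topological sequence entropy of `T` (on a compact space) along the sequence `a`: the
supremum over all open covers. -/
def topSeqEntropy {X : Type u} [TopologicalSpace X] (T : X → X) (a : ℕ → ℕ) : EReal :=
  ⨆ (𝒰 : Set (Set X)) (_ : (∀ V ∈ 𝒰, IsOpen V) ∧ ⋃₀ 𝒰 = univ), seqEntropyOfCover T a 𝒰

/-- A (compact) system is null if its topological sequence entropy vanishes along every
increasing sequence of nonnegative integers. -/
def IsNullSystem {X : Type u} [TopologicalSpace X] (T : X → X) : Prop :=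
  ∀ a : ℕ → ℕ, StrictMono a → topSeqEntropy T a = 0

/-- The rotation `y ↦ y + g₀` of `G` is the maximal equicontinuous factor of `(X, T)`, i.e. the
largest group rotation that is a factor of `(X, T)`: every compact Hausdorff group rotation that is
a factor of `(X, T)` is a factor of `(G, + g₀)`, compatibly with the factor maps from `X`.
(Any compact Hausdorff factor of `X` is a quotient of `X`, so the universe of `X` suffices for
`H`. For minimal `T`, the group of a rotation that is a factor of `X` is necessarily abelian.) -/
def IsMaximalEquicontinuousFactor {X : Type u} [TopologicalSpace X] (T : X → X)
    {G : Type v} [AddCommGroup G] [TopologicalSpace G] (g₀ : G) : Prop :=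
  ∃ π : X → G, IsFactorMap T (fun y => y + g₀) π ∧
    ∀ (H : Type u) [AddCommGroup H] [TopologicalSpace H] [IsTopologicalAddGroup H]
      [CompactSpace H] [T2Space H] (h₀ : H) (ψ : X → H),
      IsFactorMap T (fun y => y + h₀) ψ →
        ∃ ρ : G → H, IsFactorMap (fun y => y + g₀) (fun y => y + h₀) ρ ∧ ρ ∘ π = ψ

end Dynamics

/-! ### One-sided subshifts over `{0, 1}` and maximal pattern complexity -/

section Subshifts

/-- A subshift is minimal if it is nonempty and properly contains no nonempty subshift. -/
def IsMinimalSubshift (X : Subshift (Fin 2) ℕ) : Prop :=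
  X.carrier.Nonempty ∧
    ∀ Y : Subshift (Fin 2) ℕ, Y.carrier ⊆ X.carrier → Y.carrier.Nonempty → Y.carrier = X.carrier

/-- The restriction to `X` of the left shift `(σ x)(n) = x (1 + n)`. -/
def subshiftMap (X : Subshift (Fin 2) ℕ) : X.carrier → X.carrier :=
  (X.mapsTo 1).restrict (shift 1) X.carrier X.carrier

/-- The `τ`-language of `X`: all words `(σⁿ x)(τ) ∈ {0, 1}^τ` with `x ∈ X` and `n ≥ 0`. -/
def windowLanguage (X : Subshift (Fin 2) ℕ) (τ : Finset ℕ) : Set (τ → Fin 2) :=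
  {w | ∃ x ∈ X.carrier, ∃ n : ℕ, w = fun s : τ => shift n x s}

/-- The maximal pattern complexity `p*_X(n)`: the maximum of `|L_X(τ)|` over the windows `τ` of
size `n` (a maximum because `|L_X(τ)| ≤ 2 ^ n`). -/
def maxPatternComplexity (X : Subshift (Fin 2) ℕ) (n : ℕ) : ℕ :=
  sSup {m : ℕ | ∃ τ : Finset ℕ, τ.card = n ∧ m = (windowLanguage X τ).ncard}

/-- Non-superlinear maximal pattern complexity: `liminf p*_X(n) / n < ∞`. -/
def NonSuperlinearPatternComplexity (X : Subshift (Fin 2) ℕ) : Prop :=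
  liminf (fun n : ℕ => (maxPatternComplexity X n : ℝ≥0∞) / (n : ℝ≥0∞)) atTop < ⊤

/-- `{U 0, U 1, B}` is a partition of `G` with `U 0`, `U 1` open and nonempty and `B` their common
boundary, for which the coding of the orbit of the identity under `y ↦ y + g₀` is a
(well-defined) point of `X`. When `(G, + g₀)` is the maximal equicontinuous factor of `X`, this is
what is called an MEF partition associated to `X`. -/
structure IsMEFPartition (X : Subshift (Fin 2) ℕ) {G : Type*} [AddCommGroup G]
    [TopologicalSpace G] (g₀ : G) (U : Fin 2 → Set G) (B : Set G) : Prop where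
  isOpen : ∀ i, IsOpen (U i)
  nonempty : ∀ i, (U i).Nonempty
  disjoint : Disjoint (U 0) (U 1)
  disjoint_boundary : ∀ i, Disjoint (U i) B
  cover : U 0 ∪ U 1 ∪ B = univ
  frontier_eq : ∀ i, frontier (U i) = B
  coding : ∃ x₀ ∈ X.carrier, ∀ n : ℕ, n • g₀ ∉ B ∧ ∀ i : Fin 2, x₀ n = i ↔ n • g₀ ∈ U i

end Subshifts

end

/-! ### Dense orbits in the subshift and in the rotation -/

section OrbitClosure

/-! Each finite `F ⊆ B` forces growth of slope `F.card`. Choose a window `τ₀` whose codings separate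
the points of `F`, even after a small translation. Given `τ ⊇ τ₀`, density of the orbit yields a
time `t` with `t • g₀` near `0` such that the points `b - t • g₀`, `b ∈ F`, have well-defined and
distinct words along `τ`. At time `t` each of them reaches `b ∈ B`, where both pieces accumulate, so
each word continues with both symbols: adding `t` to `τ` gains at least `F.card` words
(`ncard_windowLanguage_add_card_le`). Iterating gives `exists_card_mul_le`, from which both claims
follow.

Separation (`exists_separating_nsmul`) is where the factor map enters: a translation preserving the
partition is a limit of return times of the coded point, so `π` forces it to be trivial. -/

lemma coe_iterate_subshiftMap (X : Subshift (Fin 2) ℕ) (x : X.carrier) (n : ℕ) :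
    (((subshiftMap X)^[n] x : X.carrier) : ℕ → Fin 2) = shift n (x : ℕ → Fin 2) := by
  induction n with
  | zero => ext m; simp
  | succ n ih =>
    rw [Function.iterate_succ_apply']
    change shift 1 (((subshiftMap X)^[n] x : X.carrier) : ℕ → Fin 2) = _
    rw [ih]
    ext m
    simp only [SymbolicDynamics.FullShift.shift_apply]
    rw [add_assoc]

lemma IsMinimalSubshift.closure_orbit {X : Subshift (Fin 2) ℕ} (hX : IsMinimalSubshift X)
    {x : ℕ → Fin 2} (hx : x ∈ X.carrier) :
    closure (range fun n : ℕ => shift n x) = X.carrier := by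
  let Y : Subshift (Fin 2) ℕ :=
    { carrier := closure (range fun n : ℕ => shift n x)
      isClosed := isClosed_closure
      mapsTo := fun m => by
        refine MapsTo.closure ?_ (SymbolicDynamics.FullShift.continuous_shift m)
        rintro _ ⟨n, rfl⟩
        exact ⟨n + m, SymbolicDynamics.FullShift.shift_add n m x⟩ }
  refine hX.2 Y ?_ ⟨_, subset_closure ⟨0, rfl⟩⟩
  refine closure_minimal ?_ X.isClosed
  rintro _ ⟨n, rfl⟩
  exact X.mapsTo n hx

lemma IsMinimalSubshift.denseRange_iterate {X : Subshift (Fin 2) ℕ} (hX : IsMinimalSubshift X)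
    (x : X.carrier) : DenseRange fun n : ℕ => (subshiftMap X)^[n] x := by
  rw [DenseRange, Subtype.dense_iff, ← range_comp]
  have h : (Subtype.val ∘ fun n : ℕ => (subshiftMap X)^[n] x) =
      fun n : ℕ => shift n (x : ℕ → Fin 2) :=
    funext fun n => coe_iterate_subshiftMap X x n
  rw [h, hX.closure_orbit x.2]

lemma Function.Semiconj.apply_iterate_add_right {X G : Type*} [AddCommGroup G] {T : X → X}
    {g₀ : G} {π : X → G} (h : Function.Semiconj π T fun y => y + g₀) (x : X) (n : ℕ) :
    π (T^[n] x) = n • g₀ + π x := by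
  induction n with
  | zero => simp
  | succ n ih =>
    rw [Function.iterate_succ_apply', h.eq, ih, succ_nsmul]
    abel

/-- A dense orbit in `X` maps to a dense orbit of some `π x`; translating by `-π x` moves it to the
orbit of `0`. -/
lemma IsMinimalSubshift.denseRange_nsmul {X : Subshift (Fin 2) ℕ} (hX : IsMinimalSubshift X)
    {G : Type*} [AddCommGroup G] [TopologicalSpace G] [IsTopologicalAddGroup G] {g₀ : G}
    {π : X.carrier → G} (hπ : IsFactorMap (subshiftMap X) (fun y => y + g₀) π) :
    DenseRange fun n : ℕ => n • g₀ := by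
  obtain ⟨x, hx⟩ := hX.1
  have h₁ : DenseRange (π ∘ fun n : ℕ => (subshiftMap X)^[n] ⟨x, hx⟩) :=
    hπ.surjective.denseRange.comp (hX.denseRange_iterate ⟨x, hx⟩) hπ.continuous
  have h₂ := (Homeomorph.addRight (-π ⟨x, hx⟩)).surjective.denseRange.comp h₁
    (Homeomorph.addRight (-π ⟨x, hx⟩)).continuous
  convert h₂ using 2 with n
  simp [hπ.semiconj.apply_iterate_add_right]

end OrbitClosure

/-! ### Separation and generic translates for the partition -/

section Partition

variable {X : Subshift (Fin 2) ℕ} {G : Type*} [AddCommGroup G] [TopologicalSpace G]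
  {g₀ : G} {U : Fin 2 → Set G} {B : Set G}

lemma IsMEFPartition.disjoint_of_ne (hU : IsMEFPartition X g₀ U B) {i j : Fin 2} (hij : i ≠ j) :
    Disjoint (U i) (U j) := by
  fin_cases i <;> fin_cases j
  · exact absurd rfl hij
  · exact hU.disjoint
  · exact hU.disjoint.symm
  · exact absurd rfl hij

lemma IsMEFPartition.exists_mem_of_notMem (hU : IsMEFPartition X g₀ U B) {y : G} (hy : y ∉ B) :
    ∃ i, y ∈ U i := by
  rcases hU.cover.ge (mem_univ y) with (h | h) | h
  · exact ⟨0, h⟩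
  · exact ⟨1, h⟩
  · exact absurd h hy

lemma IsMEFPartition.subset_closure (hU : IsMEFPartition X g₀ U B) (i : Fin 2) :
    B ⊆ closure (U i) :=
  hU.frontier_eq i ▸ frontier_subset_closure

lemma IsMEFPartition.isClosed_boundary (hU : IsMEFPartition X g₀ U B) : IsClosed B :=
  hU.frontier_eq 0 ▸ isClosed_frontier

lemma IsMEFPartition.isNowhereDense_boundary (hU : IsMEFPartition X g₀ U B) :
    IsNowhereDense B := by
  rw [hU.isClosed_boundary.isNowhereDense_iff, ← hU.frontier_eq 0]
  rw [← frontier_compl]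
  exact interior_frontier (hU.isOpen 0).isClosed_compl

/-- The pieces of the partition are regular open: an open set that avoids the other piece is
contained in the piece. -/
lemma IsMEFPartition.subset_of_disjoint (hU : IsMEFPartition X g₀ U B) {i j : Fin 2}
    (hij : i ≠ j) {W : Set G} (hW : IsOpen W) (h : Disjoint W (U j)) : W ⊆ U i := by
  intro y hy
  have hB : y ∉ B := fun hB =>
    (h.closure_right hW).le_bot ⟨hy, hU.subset_closure j hB⟩
  obtain ⟨l, hl⟩ := hU.exists_mem_of_notMem hB
  have hlj : l ≠ j := by
    rintro rfl
    exact h.le_bot ⟨hy, hl⟩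
  have : l = i := by omega
  exact this ▸ hl

variable [IsTopologicalAddGroup G]

/-- A translation that maps both pieces of the partition into themselves is trivial. -/
lemma IsMEFPartition.eq_zero_of_forall_add_mem [T2Space G] (hU : IsMEFPartition X g₀ U B)
    {π : X.carrier → G} (hπ : IsFactorMap (subshiftMap X) (fun y => y + g₀) π)
    (hd : DenseRange fun n : ℕ => n • g₀) {h : G}
    (hh : ∀ i, ∀ y ∈ U i, y + h ∈ U i) : h = 0 := by
  obtain ⟨x₀, hx₀, hc⟩ := hU.coding
  let x : X.carrier := ⟨x₀, hx₀⟩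
  -- The times `n` along which `n • g₀` tends to `h`; a filter avoids assuming first countability of
  -- `G`.
  let l : Filter ℕ := comap (fun n : ℕ => n • g₀) (𝓝 h)
  have hl : Tendsto (fun n : ℕ => n • g₀) l (𝓝 h) := tendsto_comap
  have : l.NeBot := by
    refine comap_neBot fun t ht => ?_
    obtain ⟨_, hy, n, rfl⟩ := mem_closure_iff_nhds.1 (hd h) t ht
    exact ⟨n, hy⟩
  -- These are return times of `x`: the point `m • g₀ + h` lies in the same open piece as `m • g₀`,
  -- so each symbol stabilizes.
  have hx : Tendsto (fun n => (subshiftMap X)^[n] x) l (𝓝 x) := by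
    rw [tendsto_subtype_rng, tendsto_pi_nhds]
    intro m
    refine tendsto_nhds_of_eventually_eq ?_
    have hm : m • g₀ ∈ U (x₀ m) := ((hc m).2 _).1 rfl
    have hlim : Tendsto (fun n : ℕ => m • g₀ + n • g₀) l (𝓝 (m • g₀ + h)) := hl.const_add _
    filter_upwards [hlim ((hU.isOpen _).mem_nhds (hh _ _ hm))] with n hn
    rw [coe_iterate_subshiftMap]
    refine ((hc (n + m)).2 _).2 ?_
    rwa [add_nsmul, add_comm]
  have h₁ : Tendsto (fun n => π ((subshiftMap X)^[n] x)) l (𝓝 (π x)) :=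
    (hπ.continuous.tendsto x).comp hx
  have h₂ : Tendsto (fun n => π ((subshiftMap X)^[n] x)) l (𝓝 (h + π x)) := by
    simp_rw [hπ.semiconj.apply_iterate_add_right]
    exact hl.add_const _
  simpa using tendsto_nhds_unique h₂ h₁

/-- Any two distinct points can be translated simultaneously into different pieces. -/
lemma IsMEFPartition.exists_separating_nsmul [T2Space G] (hU : IsMEFPartition X g₀ U B)
    {π : X.carrier → G} (hπ : IsFactorMap (subshiftMap X) (fun y => y + g₀) π)
    (hd : DenseRange fun n : ℕ => n • g₀) {b c : G} (hbc : b ≠ c) :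
    ∃ (s : ℕ) (i j : Fin 2), i ≠ j ∧ b + s • g₀ ∈ U i ∧ c + s • g₀ ∈ U j := by
  by_contra! hcon
  -- Without separating times, density forbids translation by `c - b` from carrying a point of one
  -- piece into the other.
  have key : ∀ i j : Fin 2, i ≠ j → ∀ y ∈ U i, y + (c - b) ∉ U j := by
    intro i j hij y hy hy'
    have hopen : IsOpen ((fun z => b + z) ⁻¹' U i ∩ (fun z => c + z) ⁻¹' U j) :=
      ((hU.isOpen i).preimage (by fun_prop)).inter ((hU.isOpen j).preimage (by fun_prop))
    obtain ⟨s, hs⟩ := hd.exists_mem_open hopen ⟨y - b, by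
      refine ⟨?_, ?_⟩
      · simpa using hy
      · have : c + (y - b) = y + (c - b) := by abel
        simpa only [mem_preimage, this] using hy'⟩
    exact hcon s i j hij hs.1 hs.2
  refine hbc (sub_eq_zero.1 (hU.eq_zero_of_forall_add_mem hπ hd (h := c - b) ?_)).symm
  intro i y hy
  -- The translate of `U i` could still meet `B`; regular openness rules this out.
  obtain ⟨j, hij⟩ := exists_ne i
  have hW : IsOpen ((fun z => z - (c - b)) ⁻¹' U i) := (hU.isOpen i).preimage (by fun_prop)
  refine hU.subset_of_disjoint hij.symm hW ?_ (a := y + (c - b)) (by simpa using hy)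
  rw [Set.disjoint_left]
  intro z hz hz'
  exact key i j hij.symm _ hz (by simpa using hz')

/-- Finitely many points are pairwise separated by the codings along a common finite window,
stably under small translations. -/
lemma IsMEFPartition.exists_separating_window [T2Space G] (hU : IsMEFPartition X g₀ U B)
    {π : X.carrier → G} (hπ : IsFactorMap (subshiftMap X) (fun y => y + g₀) π)
    (hd : DenseRange fun n : ℕ => n • g₀) (F : Finset G) :
    ∃ τ : Finset ℕ, ∀ᶠ v in 𝓝 (0 : G), ∀ b ∈ F, ∀ c ∈ F, b ≠ c →
      ∃ s ∈ τ, ∃ i j : Fin 2, i ≠ j ∧ b - v + s • g₀ ∈ U i ∧ c - v + s • g₀ ∈ U j := by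
  classical
  choose! s i j hij hi hj using fun b c (h : b ≠ c) => hU.exists_separating_nsmul hπ hd h
  refine ⟨(F ×ˢ F).image fun p => s p.1 p.2, ?_⟩
  rw [Filter.eventually_all_finset]
  intro b hb
  rw [Filter.eventually_all_finset]
  intro c hc
  by_cases hbc : b = c
  · exact Eventually.of_forall fun v h => absurd hbc h
  have aux : ∀ (a : G) (m : ℕ) (l : Fin 2), a + m • g₀ ∈ U l →
      ∀ᶠ v in 𝓝 (0 : G), a - v + m • g₀ ∈ U l := by
    intro a m l h
    have : Continuous fun v : G => a - v + m • g₀ := by fun_prop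
    exact this.continuousAt.eventually_mem ((hU.isOpen l).mem_nhds (by simpa using h))
  filter_upwards [aux _ _ _ (hi b c hbc), aux _ _ _ (hj b c hbc)] with v h₁ h₂ _
  exact ⟨s b c, Finset.mem_image.2 ⟨(b, c), Finset.mk_mem_product hb hc, rfl⟩,
    i b c, j b c, hij b c hbc, h₁, h₂⟩

/-- There is a time `t` with `t • g₀` in a given open set such that no point `b - t • g₀ + s • g₀`
with `b ∈ F`, `s ∈ τ` lies on the boundary. -/
lemma IsMEFPartition.exists_nsmul_avoiding (hU : IsMEFPartition X g₀ U B)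
    (hd : DenseRange fun n : ℕ => n • g₀) (F : Finset G) (τ : Finset ℕ) {V : Set G}
    (hV : IsOpen V) (hne : V.Nonempty) :
    ∃ t : ℕ, t • g₀ ∈ V ∧ ∀ b ∈ F, ∀ s ∈ τ, b - t • g₀ + s • g₀ ∉ B := by
  have hdense : ∀ p : G × ℕ, IsOpen ((fun y => p.1 - y + p.2 • g₀) ⁻¹' Bᶜ) ∧
      Dense ((fun y => p.1 - y + p.2 • g₀) ⁻¹' Bᶜ) := by
    intro p
    -- A homeomorphism, so each pair `(b, s)` excludes only a closed nowhere dense set of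
    -- translations.
    let e : G ≃ₜ G := (Homeomorph.subLeft p.1).trans (Homeomorph.addRight (p.2 • g₀))
    have hB := hU.isClosed_boundary.isOpen_compl
    have hB' : Dense Bᶜ := by
      rw [← interior_eq_empty_iff_dense_compl,
        ← hU.isClosed_boundary.isNowhereDense_iff]
      exact hU.isNowhereDense_boundary
    exact ⟨hB.preimage e.continuous, hB'.preimage e.isOpenMap⟩
  have hall : ∀ S : Finset (G × ℕ),
      IsOpen (⋂ p ∈ S, (fun y => p.1 - y + p.2 • g₀) ⁻¹' Bᶜ) ∧
      Dense (⋂ p ∈ S, (fun y => p.1 - y + p.2 • g₀) ⁻¹' Bᶜ) := by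
    classical
    intro S
    induction S using Finset.induction_on with
    | empty => simp
    | insert p S _ ih =>
      rw [Finset.set_biInter_insert]
      exact ⟨(hdense p).1.inter ih.1, (hdense p).2.inter_of_isOpen_left ih.2 (hdense p).1⟩
  obtain ⟨ho, hD⟩ := hall (F ×ˢ τ)
  obtain ⟨t, ht⟩ := hd.exists_mem_open (hV.inter ho) (hD.inter_open_nonempty V hV hne)
  refine ⟨t, ht.1, fun b hb s hs => ?_⟩
  have := mem_iInter₂.1 ht.2 (b, s) (Finset.mk_mem_product hb hs)
  exact this

/-- If the points `y + s • g₀`, `s ∈ τ`, avoid the boundary while `y + t • g₀` lies on it, then the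
word read off at `y` along `τ` can be continued at `t` by either symbol. -/
lemma IsMEFPartition.exists_word (hU : IsMEFPartition X g₀ U B)
    (hd : DenseRange fun n : ℕ => n • g₀) (τ : Finset ℕ) {y : G} {t : ℕ} {w : ℕ → Fin 2}
    (hw : ∀ s ∈ τ, y + s • g₀ ∈ U (w s)) (ht : y + t • g₀ ∈ B) (a : Fin 2) :
    ∃ x ∈ X.carrier, ∃ n : ℕ, (∀ s ∈ τ, shift n x s = w s) ∧ shift n x t = a := by
  obtain ⟨x₀, hx₀, hc⟩ := hU.coding
  have hopen : IsOpen (⋂ s ∈ τ, (fun z => z + s • g₀) ⁻¹' U (w s)) :=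
    isOpen_biInter_finset fun s _ => (hU.isOpen _).preimage (by fun_prop)
  have hopen' : IsOpen ((fun z => z + t • g₀) '' (⋂ s ∈ τ, (fun z => z + s • g₀) ⁻¹' U (w s))) :=
    (Homeomorph.addRight (t • g₀)).isOpenMap _ hopen
  -- Perturb `y` to `z`, keeping the word along `τ` but pushing the boundary point into `U a`.
  obtain ⟨_, ⟨z, hz, rfl⟩, hza⟩ := mem_closure_iff.1 (hU.subset_closure a ht) _ hopen'
    ⟨y, mem_iInter₂.2 hw, rfl⟩
  have hcont : Continuous fun z => z + t • g₀ := by fun_prop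
  obtain ⟨n, hn, hn'⟩ := hd.exists_mem_open
    (hopen.inter ((hU.isOpen a).preimage hcont)) ⟨z, hz, hza⟩
  refine ⟨x₀, hx₀, n, fun s hs => ((hc (n + s)).2 _).2 ?_, ((hc (n + t)).2 _).2 ?_⟩
  · rw [add_nsmul]
    exact mem_iInter₂.1 hn s hs
  · rw [add_nsmul]
    exact hn'

end Partition

/-! ### Counting words along windows -/

section Counting

lemma windowLanguage_finite (X : Subshift (Fin 2) ℕ) (τ : Finset ℕ) :
    (windowLanguage X τ).Finite :=
  toFinite _

lemma ncard_windowLanguage_le (X : Subshift (Fin 2) ℕ) (τ : Finset ℕ) :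
    (windowLanguage X τ).ncard ≤ maxPatternComplexity X τ.card := by
  refine le_csSup ⟨2 ^ τ.card, ?_⟩ ⟨τ, rfl, rfl⟩
  rintro _ ⟨τ', hτ', rfl⟩
  refine (ncard_le_ncard (subset_univ _)).trans ?_
  simp [ncard_univ, hτ']

/-- If a map `r` sends `S` onto `T` and has at least two preimages in `S` over each point of
`D`, then `S` has at least `|T| + |D|` elements. -/
lemma ncard_add_ncard_le_of_two_preimages {α β : Type*} [Nonempty α] {S : Set α} {T D : Set β} (hS : S.Finite)
    (r : α → β) (hr : ∀ w ∈ T, ∃ v ∈ S, r v = w)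
    (hD : ∀ w ∈ D, ∃ v ∈ S, ∃ v' ∈ S, v ≠ v' ∧ r v = w ∧ r v' = w) :
    T.ncard + D.ncard ≤ S.ncard := by
  -- `e` selects one preimage over `T` and `f` below a different one over `D`; their images are
  -- disjoint.
  choose! e heS he using hr
  have hex : ∀ w ∈ D, ∃ v ∈ S, r v = w ∧ v ≠ e w := by
    intro w hw
    obtain ⟨v, hv, v', hv', hne, h, h'⟩ := hD w hw
    by_cases hve : v = e w
    · exact ⟨v', hv', h', fun h'' => hne (hve.trans h''.symm)⟩
    · exact ⟨v, hv, h, hve⟩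
  choose! f hfS hf hfe using hex
  have heT : InjOn e T := fun a ha b hb hab => by rw [← he a ha, ← he b hb, hab]
  have hfD : InjOn f D := fun a ha b hb hab => by rw [← hf a ha, ← hf b hb, hab]
  have hdisj : Disjoint (e '' T) (f '' D) := by
    rw [Set.disjoint_left]
    rintro _ ⟨a, ha, rfl⟩ ⟨b, hb, hab⟩
    have : a = b := by rw [← he a ha, ← hf b hb, hab]
    exact hfe b hb (this ▸ hab)
  have hsub : e '' T ∪ f '' D ⊆ S := by
    rintro _ (⟨a, ha, rfl⟩ | ⟨b, hb, rfl⟩)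
    · exact heS a ha
    · exact hfS b hb
  rw [← heT.ncard_image, ← hfD.ncard_image, ← ncard_union_eq hdisj
    (hS.subset (subset_union_left.trans hsub)) (hS.subset (subset_union_right.trans hsub))]
  exact ncard_le_ncard hsub hS

/-- Passing from `τ` to `insert t τ` creates at least as many new words as there are words along
`τ` that are continued at `t` by both symbols. -/
lemma ncard_windowLanguage_add_card_le (X : Subshift (Fin 2) ℕ) (τ : Finset ℕ) (t : ℕ)
    {ι : Type*} (F : Finset ι) (w : ι → ℕ → Fin 2)
    (hw : ∀ b ∈ F, ∀ c ∈ F, b ≠ c → ∃ s ∈ τ, w b s ≠ w c s)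
    (hext : ∀ b ∈ F, ∀ a : Fin 2, ∃ x ∈ X.carrier, ∃ n : ℕ,
      (∀ s ∈ τ, shift n x s = w b s) ∧ shift n x t = a) :
    (windowLanguage X τ).ncard + F.card ≤ (windowLanguage X (insert t τ)).ncard := by
  let r : (((insert t τ : Finset ℕ)) → Fin 2) → (τ → Fin 2) :=
    fun v s => v ⟨s, Finset.mem_insert_of_mem s.2⟩
  let W : ι → τ → Fin 2 := fun b s => w b s
  have hinj : InjOn W F := by
    intro b hb c hc hbc
    by_contra hne
    obtain ⟨s, hs, h⟩ := hw b hb c hc hne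
    exact h (congrFun hbc ⟨s, hs⟩)
  rw [← ncard_coe_finset F, ← hinj.ncard_image]
  refine ncard_add_ncard_le_of_two_preimages (windowLanguage_finite X _) r ?_ ?_
  · rintro _ ⟨x, hx, n, rfl⟩
    exact ⟨_, ⟨x, hx, n, rfl⟩, rfl⟩
  · rintro _ ⟨b, hb, rfl⟩
    obtain ⟨x, hx, n, h, h0⟩ := hext b hb 0
    obtain ⟨x', hx', n', h', h1⟩ := hext b hb 1
    refine ⟨_, ⟨x, hx, n, rfl⟩, _, ⟨x', hx', n', rfl⟩, fun heq => ?_,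
      funext fun s => h s s.2, funext fun s => h' s s.2⟩
    have := congrFun heq ⟨t, Finset.mem_insert_self t τ⟩
    simp only [h0, h1] at this
    exact absurd this (by decide)

end Counting

/-! ### Linear lower bounds and the theorem -/

/-- Every finite set of boundary points of an MEF partition bounds the slope of the maximal pattern
complexity from below. -/
theorem IsMEFPartition.exists_card_mul_le {X : Subshift (Fin 2) ℕ} (hX : IsMinimalSubshift X)
    {G : Type*} [AddCommGroup G] [TopologicalSpace G] [IsTopologicalAddGroup G] [T2Space G]
    {g₀ : G} {π : X.carrier → G} (hπ : IsFactorMap (subshiftMap X) (fun y => y + g₀) π)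
    {U : Fin 2 → Set G} {B : Set G} (hU : IsMEFPartition X g₀ U B) (F : Finset G)
    (hF : (F : Set G) ⊆ B) :
    ∃ C : ℕ, ∀ n : ℕ, F.card * n ≤ maxPatternComplexity X n + C := by
  rcases F.eq_empty_or_nonempty with rfl | ⟨b₀, hb₀⟩
  · exact ⟨0, fun n => by simp⟩
  have hd := hX.denseRange_nsmul hπ
  obtain ⟨τ₀, hτ₀⟩ := hU.exists_separating_window hπ hd F
  obtain ⟨V, hV, hVo, hV0⟩ := eventually_nhds_iff.1 hτ₀
  have step : ∀ τ : Finset ℕ, τ₀ ⊆ τ → ∃ t ∉ τ,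
      (windowLanguage X τ).ncard + F.card ≤ (windowLanguage X (insert t τ)).ncard := by
    intro τ hτ
    obtain ⟨t, htV, ht⟩ := hU.exists_nsmul_avoiding hd F τ hVo ⟨0, hV0⟩
    -- If `t` were in `τ`, taking `s = t` would put `b₀` itself outside `B`.
    refine ⟨t, fun htτ => ht b₀ hb₀ t htτ (by simpa using hF hb₀), ?_⟩
    choose! w hw using fun b hb s hs => hU.exists_mem_of_notMem (ht b hb s hs)
    refine ncard_windowLanguage_add_card_le X τ t F w ?_ ?_
    · intro b hb c hc hbc
      obtain ⟨s, hs, i, j, hij, hi, hj⟩ := hV _ htV b hb c hc hbc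
      refine ⟨s, hτ hs, fun heq => ?_⟩
      have hwi : w b s = i := by
        by_contra h
        exact (hU.disjoint_of_ne h).le_bot ⟨hw b hb s (hτ hs), hi⟩
      have hwj : w c s = j := by
        by_contra h
        exact (hU.disjoint_of_ne h).le_bot ⟨hw c hc s (hτ hs), hj⟩
      exact hij (hwi ▸ hwj ▸ heq)
    · intro b hb a
      exact hU.exists_word hd τ (hw b hb) (by simpa using hF hb) a
  have grow : ∀ m : ℕ, ∃ τ : Finset ℕ, τ₀ ⊆ τ ∧ τ.card = τ₀.card + m ∧
      F.card * m ≤ (windowLanguage X τ).ncard := by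
    intro m
    induction m with
    | zero => exact ⟨τ₀, subset_rfl, rfl, by simp⟩
    | succ m ih =>
      obtain ⟨τ, hτ, hcard, hle⟩ := ih
      obtain ⟨t, ht, hle'⟩ := step τ hτ
      refine ⟨insert t τ, hτ.trans (Finset.subset_insert t τ), ?_, ?_⟩
      · rw [Finset.card_insert_of_notMem ht, hcard, add_assoc]
      · rw [mul_add, mul_one]
        omega
  -- The constant pays for the positions of `τ₀`, which are credited with no words.
  refine ⟨F.card * τ₀.card, fun n => ?_⟩
  rcases le_total n τ₀.card with hn | hn
  · exact (Nat.mul_le_mul_left _ hn).trans (Nat.le_add_left _ _)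
  · obtain ⟨m, rfl⟩ := Nat.exists_eq_add_of_le hn
    obtain ⟨τ, -, hcard, hle⟩ := grow m
    have := ncard_windowLanguage_le X τ
    rw [hcard] at this
    rw [mul_add]
    omega

/-- A sequence that is eventually above every linear function up to a constant is superlinear. -/
lemma liminf_div_eq_top {p : ℕ → ℕ} (h : ∀ k : ℕ, ∃ C : ℕ, ∀ n, k * n ≤ p n + C) :
    liminf (fun n : ℕ => (p n : ℝ≥0∞) / (n : ℝ≥0∞)) atTop = ⊤ := by
  refine ENNReal.eq_top_of_forall_nnreal_le fun q => ?_
  obtain ⟨k, hk⟩ := exists_nat_ge q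
  obtain ⟨C, hC⟩ := h (k + 1)
  -- The slope `k + 1` leaves a spare `n` that absorbs `C` once `n > C`, which also makes the
  -- divisor nonzero.
  refine le_liminf_of_le (by isBoundedDefault) ?_
  filter_upwards [eventually_ge_atTop (C + 1)] with n hn
  have hkn : k * n ≤ p n := by
    have := hC n
    rw [add_mul, one_mul] at this
    omega
  have hq : (q : ℝ≥0∞) ≤ (k : ℝ≥0∞) := by exact_mod_cast hk
  refine hq.trans ?_
  rw [ENNReal.le_div_iff_mul_le (Or.inl (by simp; omega)) (Or.inl (by simp))]
  exact_mod_cast hkn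

theorem theorem4p1 (X : Subshift (Fin 2) ℕ) (hX : IsMinimalSubshift X)
    {G : Type*} [AddCommGroup G] [TopologicalSpace G] [IsTopologicalAddGroup G]
    [CompactSpace G] [T2Space G] (g₀ : G)
    (hG : IsMaximalEquicontinuousFactor (subshiftMap X) g₀)
    (U : Fin 2 → Set G) (B : Set G) (hU : IsMEFPartition X g₀ U B) :
    (IsNullSystem (subshiftMap X) → ∀ k : ℕ, (k : ℕ∞) ≤ B.encard →
      BddBelow (range fun n : ℕ => (maxPatternComplexity X n : ℝ) - (k : ℝ) * (n : ℝ))) ∧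
    (NonSuperlinearPatternComplexity X → B.Finite) := by
  obtain ⟨π, hπ, -⟩ := hG
  have main : ∀ k : ℕ, (k : ℕ∞) ≤ B.encard →
      ∃ C : ℕ, ∀ n : ℕ, k * n ≤ maxPatternComplexity X n + C := by
    intro k hk
    obtain ⟨S, hSB, hS⟩ := exists_subset_encard_eq hk
    have hfin : S.Finite := finite_of_encard_eq_coe hS
    obtain ⟨C, hC⟩ := hU.exists_card_mul_le hX hπ hfin.toFinset (by simpa using hSB)
    have hcard : hfin.toFinset.card = k := by
      rw [hfin.encard_eq_coe_toFinset_card] at hS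
      exact_mod_cast hS
    exact ⟨C, hcard ▸ hC⟩
  refine ⟨fun _ k hk => ?_, fun hp => ?_⟩
  · obtain ⟨C, hC⟩ := main k hk
    refine ⟨-(C : ℝ), ?_⟩
    rintro _ ⟨n, rfl⟩
    have : (k : ℝ) * n ≤ maxPatternComplexity X n + C := by exact_mod_cast hC n
    dsimp only
    linarith
  · by_contra hB
    have hB' : B.encard = ⊤ := encard_eq_top hB
    exact hp.ne (liminf_div_eq_top fun k => main k (by simp [hB']))
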